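/- Let $r\ge 3$ and let $l\ge 5$ be odd. An $r$-uniform loose cycle of length $l$, denoted $C_l^r$, is a hypergraph with $l$ edges $e_1,\dots,e_l$, each of size $r$, such that for $i\neq j$ we have $|e_i\cap e_j|=1$ if $j\equiv i\pm 1 \pmod l$ and $e_i\cap e_j=\emptyset$ otherwise. Let $K_n^r$ denote the complete $r$-uniform hypergraph on $n$ vertices, and let $R(C_l^r,K_n^r)$ be the least integer $m$ such that every colouring of the edges of $K_m^r$ with red and blue contains a copy of $C_l^r$ all of whose edges are red or a copy of $K_n^r$ all of whose edges are blue. Then there is a constant $c_{r,l}>0$, depending only on $r$ and $l$, such that for every integer $n\ge 1$ the number $R(C_l^r,K_n^r)$ exists and $$R(C_l^r,K_n^r)\le c_{r,l}\, n^{1+1/\lfloor l/2\rfloor}.$$ -/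

import Mathlib

namespace LooseCycleRamsey

/-- The edges of the complete `r`-uniform hypergraph on the vertex set `V`. -/
abbrev CompleteEdge (V : Type*) (r : ℕ) : Type _ := {e : Finset V // e.card = r}

/-- The two colours. -/
inductive Color
  | red
  | blue

/-- The sets `e i`, indexed cyclically by `i : ZMod l`, are the edges of a loose cycle of length
`l`: cyclically consecutive edges share exactly one vertex, and any two other edges are
disjoint. (For `l ≥ 4` and edges of size at least `2` the `l` edges are then pairwise distinct.) -/
def IsLooseCycle {V : Type*} [DecidableEq V] {l : ℕ} (e : ZMod l → Finset V) : Prop :=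
  ∀ i j : ZMod l, i ≠ j →
    if j = i + 1 ∨ j = i - 1 then (e i ∩ e j).card = 1 else e i ∩ e j = ∅

/-- The coloured complete `r`-uniform hypergraph contains a red `r`-uniform loose cycle of
length `l`. -/
def HasRedLooseCycle {V : Type*} [DecidableEq V] {r : ℕ} (l : ℕ)
    (χ : CompleteEdge V r → Color) : Prop :=
  ∃ e : ZMod l → CompleteEdge V r,
    IsLooseCycle (fun i => (e i : Finset V)) ∧ ∀ i, χ (e i) = Color.red

/-- The coloured complete `r`-uniform hypergraph contains a blue `r`-uniform clique of
order `n`. -/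
def HasBlueClique {V : Type*} {r : ℕ} (n : ℕ) (χ : CompleteEdge V r → Color) : Prop :=
  ∃ S : Finset V, S.card = n ∧ ∀ e : CompleteEdge V r, (e : Finset V) ⊆ S → χ e = Color.blue

/-- Every red/blue colouring of the edges of the complete `r`-uniform hypergraph on `m` vertices
contains a red loose cycle of length `l` or a blue clique of order `n`. -/
def Arrows (r l n m : ℕ) : Prop :=
  ∀ χ : CompleteEdge (Fin m) r → Color, HasRedLooseCycle l χ ∨ HasBlueClique n χ

/-- `m` is the Ramsey number of the `r`-uniform loose cycle of length `l` versus the `r`-uniform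
clique of order `n`. -/
def IsRamseyNumber (r l n m : ℕ) : Prop :=
  IsLeast {k : ℕ | Arrows r l n k} m

end LooseCycleRamsey

/-!
Red edges are traded for smaller sets: a set `A` is robust if no small set of vertices outside `A`
meets all red edges containing `A`. The minimal robust sets of size at least two form a
hypergraph `F` of bounded codegree. Every red edge contains an edge of `F`, and a loose cycle in `F`
extends greedily to a red one, so it suffices to find a large independent set in `F` when `F` has
bounded codegree and no loose cycle of length `2 * k + 1`.

In such an `F`, the set of ends of the loose paths with `j ≤ k` edges from a fixed vertex `v`
contains an independent set of proportional size. Otherwise, after colour coding and refining,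
there is a long loose path monotone in a fixed vertex order whose vertices `x 0 < x 1 < ⋯` are path
ends such that the paths from any two of them to `v` first meet at the same place `a` and in a
single vertex. The segment of the monotone path of length `2 * k + 1 - 2 * (a + 1)` and the initial
segments of the paths at its two ends then form a loose cycle of length `2 * k + 1`.

If all independent sets have at most `n` vertices, the ends at distance `j` thus number `O(n)`, so
for some `j < k` their number grows by a factor `O(n ^ (1 / k))` at most. This yields an
independent set whose neighbourhood is at most `O(n ^ (1 / k))` times larger. Removing both and
iterating gives an independent set of size `Ω(m / n ^ (1 / k))`, whence `m = O(n ^ (1 + 1 / k))`.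
-/

namespace LooseCycleRamsey

open Finset Function

section Hypergraph

variable {V : Type*} {F F' : Finset (Finset V)}

/-- `I` is an independent set of the hypergraph `F`. -/
def IsIndep (F : Finset (Finset V)) (I : Finset V) : Prop := ∀ e ∈ F, ¬ e ⊆ I

variable [DecidableEq V]

/-- The hypergraph `F`, not necessarily uniform, contains a loose cycle of length `l`. -/
def HasLooseCycle (F : Finset (Finset V)) (l : ℕ) : Prop :=
  ∃ e : ZMod l → Finset V, IsLooseCycle e ∧ ∀ i, e i ∈ F

theorem HasLooseCycle.mono {l : ℕ} (hF : F ⊆ F') (h : HasLooseCycle F l) : HasLooseCycle F' l :=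
  let ⟨e, he, heF⟩ := h
  ⟨e, he, fun i => hF (heF i)⟩

/-- The edges of `F` have between `2` and `r` vertices, and any two vertices lie in at most `D`
common edges. -/
structure IsSparse (F : Finset (Finset V)) (r D : ℕ) : Prop where
  two_le_card : ∀ e ∈ F, 2 ≤ #e
  card_le : ∀ e ∈ F, #e ≤ r
  codegree_le : ∀ x y : V, x ≠ y → #{e ∈ F | x ∈ e ∧ y ∈ e} ≤ D

theorem IsSparse.mono {r D : ℕ} (h : IsSparse F' r D) (hF : F ⊆ F') : IsSparse F r D where
  two_le_card e he := h.two_le_card e (hF he)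
  card_le e he := h.card_le e (hF he)
  codegree_le x y hxy := (card_le_card (filter_subset_filter _ hF)).trans (h.codegree_le x y hxy)

end Hypergraph

section Robust

variable {V : Type*} {H : Finset (Finset V)} {M r : ℕ} {A : Finset V}

/-- No set of at most `M` vertices outside `A` meets all edges of `H` that contain `A`. -/
def Robust (H : Finset (Finset V)) (M : ℕ) (A : Finset V) : Prop :=
  ∀ T : Finset V, #T ≤ M → Disjoint A T → ∃ h ∈ H, A ⊆ h ∧ Disjoint h T

theorem robust_of_mem (hA : A ∈ H) : Robust H M A :=
  fun _ _ hT => ⟨A, hA, Subset.rfl, hT⟩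

theorem Robust.card_le (hA : Robust H M A) (hH : ∀ h ∈ H, #h ≤ r) : #A ≤ r := by
  obtain ⟨h, hh, hAh, -⟩ := hA ∅ (by simp) (by simp)
  exact (card_le_card hAh).trans (hH h hh)

theorem exists_extension_of_robust [DecidableEq V] {ι : Type*} [Fintype ι]
    (hH : ∀ h ∈ H, #h ≤ r) (e : ι → Finset V) (he : ∀ i, Robust H (Fintype.card ι * r) (e i)) :
    ∃ e' : ι → Finset V, (∀ i, e' i ∈ H) ∧ ∀ i j, i ≠ j → e' i ∩ e' j = e i ∩ e j := by
  classical
  suffices key : ∀ s : Finset ι, ∃ e' : ι → Finset V,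
      (∀ i, Robust H (Fintype.card ι * r) (e' i)) ∧ (∀ i ∈ s, e' i ∈ H) ∧
        ∀ i j, i ≠ j → e' i ∩ e' j = e i ∩ e j by
    obtain ⟨e', -, hmem, hinter⟩ := key univ
    exact ⟨e', fun i => hmem i (mem_univ i), hinter⟩
  intro s
  induction s using Finset.induction_on with
  | empty => exact ⟨e, he, by simp, fun _ _ _ => rfl⟩
  | insert i s _ ih =>
    obtain ⟨e', hrobust, hmem, hinter⟩ := ih
    have hcard : #(univ.biUnion e' \ e' i) ≤ Fintype.card ι * r :=
      (card_le_card sdiff_subset).trans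
        (card_biUnion_le_card_mul _ _ _ fun j _ => (hrobust j).card_le hH)
    obtain ⟨h, hh, hsub, hdisj⟩ := hrobust i _ hcard disjoint_sdiff
    have hnew : ∀ j, h ∩ e' j = e' i ∩ e' j := fun j => by
      refine Subset.antisymm (fun z hz => ?_) (inter_subset_inter_right hsub)
      rw [mem_inter] at hz ⊢
      refine ⟨by_contra fun hzi => disjoint_left.1 hdisj hz.1 ?_, hz.2⟩
      exact mem_sdiff.2 ⟨mem_biUnion.2 ⟨j, mem_univ j, hz.2⟩, hzi⟩
    refine ⟨update e' i h, (forall_update_iff e' fun _ => Robust H _).2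
      ⟨robust_of_mem hh, fun j _ => hrobust j⟩, (forall_update_iff e' fun j a => j ∈ insert i s →
        a ∈ H).2 ⟨fun _ => hh, fun j hj hjs => hmem j (mem_of_mem_insert_of_ne hjs hj)⟩, ?_⟩
    intro a b hab
    rw [← hinter a b hab]
    rcases eq_or_ne a i with rfl | ha
    · rw [update_self, update_of_ne hab.symm, hnew]
    · rcases eq_or_ne b i with rfl | hb
      · rw [update_self, update_of_ne ha, inter_comm, hnew, inter_comm]
      · rw [update_of_ne ha, update_of_ne hb]

variable [Fintype V]

open Classical in
/-- The hypergraph of the minimal robust sets with at least two elements. -/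
noncomputable def core (H : Finset (Finset V)) (M : ℕ) : Finset (Finset V) :=
  {A | Minimal (fun B => 2 ≤ #B ∧ Robust H M B) A}

theorem mem_core : A ∈ core H M ↔ Minimal (fun B => 2 ≤ #B ∧ Robust H M B) A := by
  simp [core]

theorem exists_mem_core_subset (hA2 : 2 ≤ #A) (hA : Robust H M A) : ∃ B ∈ core H M, B ⊆ A := by
  obtain ⟨B, hBA, hB⟩ := exists_minimal_le_of_wellFoundedLT
    (fun B => 2 ≤ #B ∧ Robust H M B) A ⟨hA2, hA⟩
  exact ⟨B, mem_core.2 hB, hBA⟩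

theorem IsIndep.of_core {I : Finset V} (hI : IsIndep (core H M) I) (hH : ∀ h ∈ H, 2 ≤ #h) :
    IsIndep H I := by
  intro h hh hhI
  obtain ⟨B, hB, hBh⟩ := exists_mem_core_subset (hH h hh) (robust_of_mem (M := M) hh)
  exact hI B hB (hBh.trans hhI)

variable [DecidableEq V]

theorem HasLooseCycle.of_core {l : ℕ} [NeZero l] (hH : ∀ h ∈ H, #h ≤ r)
    (h : HasLooseCycle (core H (l * r)) l) : HasLooseCycle H l := by
  obtain ⟨e, hcycle, he⟩ := h
  obtain ⟨e', hmem, hinter⟩ := exists_extension_of_robust hH e fun i => by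
    rw [ZMod.card]
    exact (mem_core.1 (he i)).prop.2
  refine ⟨e', fun i j hij => ?_, hmem⟩
  rw [hinter i j hij]
  exact hcycle i j hij

theorem card_core_superset_le_one_of_robust (hA2 : 2 ≤ #A) (hA : Robust H M A) :
    #{B ∈ core H M | A ⊆ B} ≤ 1 := by
  rw [card_le_one_iff_subset_singleton]
  refine ⟨A, fun B hB => ?_⟩
  obtain ⟨hB, hAB⟩ := mem_filter.1 hB
  exact mem_singleton.2 ((mem_core.1 hB).eq_of_le ⟨hA2, hA⟩ hAB).symm

/-- If `A` is not robust, each robust superset contains one of at most `M` further vertices. -/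
theorem card_core_superset_le (hM : 1 ≤ M) (hH : ∀ h ∈ H, #h ≤ r) (d : ℕ) (A : Finset V)
    (hA2 : 2 ≤ #A) (hd : r ≤ #A + d) : #{B ∈ core H M | A ⊆ B} ≤ M ^ d := by
  induction d generalizing A with
  | zero =>
    rw [pow_zero, card_le_one_iff_subset_singleton]
    refine ⟨A, fun B hB => ?_⟩
    obtain ⟨hB, hAB⟩ := mem_filter.1 hB
    exact mem_singleton.2
      (eq_of_subset_of_card_le hAB (((mem_core.1 hB).prop.2.card_le hH).trans hd)).symm
  | succ d ih =>
    by_cases hA : Robust H M A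
    · exact (card_core_superset_le_one_of_robust hA2 hA).trans (Nat.one_le_pow _ _ hM)
    · obtain ⟨T, hT, hAT, hmeet⟩ : ∃ T : Finset V, #T ≤ M ∧ Disjoint A T ∧
          ∀ h ∈ H, A ⊆ h → ¬ Disjoint h T := by simpa only [Robust, not_forall, not_exists,
            not_and, exists_prop] using hA
      have hsub : {B ∈ core H M | A ⊆ B} ⊆
          T.biUnion fun t => {B ∈ core H M | insert t A ⊆ B} := by
        intro B hB
        obtain ⟨hB, hAB⟩ := mem_filter.1 hB
        have hBT : ¬ Disjoint B T := fun hBT =>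
          let ⟨h, hh, hBh, hhT⟩ := (mem_core.1 hB).prop.2 T hT hBT
          hmeet h hh (hAB.trans hBh) hhT
        obtain ⟨t, htB, htT⟩ := not_disjoint_iff.1 hBT
        exact mem_biUnion.2 ⟨t, htT, mem_filter.2 ⟨hB, insert_subset htB hAB⟩⟩
      calc #{B ∈ core H M | A ⊆ B} ≤ #T * M ^ d :=
            (card_le_card hsub).trans <| card_biUnion_le_card_mul _ _ _ fun t ht => by
              have hcard := card_insert_of_notMem fun htA => disjoint_left.1 hAT htA ht
              exact ih _ (by omega) (by omega)
        _ ≤ M ^ (d + 1) := by rw [pow_succ']; exact Nat.mul_le_mul_right _ hT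

theorem isSparse_core (hM : 1 ≤ M) (hH : ∀ h ∈ H, #h ≤ r) : IsSparse (core H M) r (M ^ r) where
  two_le_card B hB := (mem_core.1 hB).prop.1
  card_le B hB := (mem_core.1 hB).prop.2.card_le hH
  codegree_le x y hxy := by
    have hcard := card_core_superset_le hM hH r {x, y} (card_pair hxy).ge (by omega)
    simpa only [insert_subset_iff, singleton_subset_iff] using hcard

end Robust

section Colouring

theorem exists_card_le_mul_card_fiber {α κ : Type*} [Fintype κ] [Nonempty κ] [DecidableEq κ]
    (s : Finset α) (c : α → κ) : ∃ a, #s ≤ Fintype.card κ * #{x ∈ s | c x = a} := by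
  have hsum : ∑ _a : κ, #s ≤ ∑ a : κ, Fintype.card κ * #{x ∈ s | c x = a} := by
    rw [← mul_sum, ← card_eq_sum_card_fiberwise fun _ _ => mem_coe.2 (mem_univ _), sum_const,
      card_univ, smul_eq_mul]
  obtain ⟨a, -, ha⟩ := exists_le_of_sum_le univ_nonempty hsum
  exact ⟨a, ha⟩

theorem exists_card_le_mul_card_filter {α β : Type*} {s : Finset α} (hs : s.Nonempty)
    (t : Finset β) (R : α → β → Prop) [∀ a b, Decidable (R a b)] {K : ℕ}
    (h : ∀ b ∈ t, #s ≤ K * #{a ∈ s | R a b}) : ∃ a ∈ s, #t ≤ K * #{b ∈ t | R a b} := by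
  refine exists_le_of_sum_le hs ?_
  calc ∑ _a ∈ s, #t = ∑ _b ∈ t, #s := by simp only [sum_const, smul_eq_mul, mul_comm]
    _ ≤ ∑ b ∈ t, K * #{a ∈ s | R a b} := sum_le_sum h
    _ = ∑ a ∈ s, K * #{b ∈ t | R a b} := by
      rw [← mul_sum, ← mul_sum]
      exact congrArg _ (sum_card_bipartiteAbove_eq_sum_card_bipartiteBelow R).symm

variable {V : Type*}

open Classical in
theorem card_colourings_le_mul_card_injOn [Fintype V] {q : ℕ} (hq : 0 < q) {P : Finset V}
    (hP : #P ≤ q) :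
    Fintype.card (V → Fin q) ≤ q ^ q * #{χ : V → Fin q | Set.InjOn χ P} := by
  have : Nonempty (Fin q) := ⟨⟨0, hq⟩⟩
  obtain ⟨g, -, hg⟩ := P.finite_toSet.exists_injOn_of_encard_le (t := (Set.univ : Set (Fin q)))
    (by simpa using hP)
  have hsub : Fintype.piFinset (fun x => if x ∈ P then {g x} else univ) ⊆
      ({χ | Set.InjOn χ P} : Finset (V → Fin q)) := fun χ hχ => by
    have hχg : Set.EqOn g χ P := fun x hx => by
      simpa [mem_coe.1 hx, eq_comm] using Fintype.mem_piFinset.1 hχ x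
    exact mem_filter.2 ⟨mem_univ _, hg.congr hχg⟩
  have hcard : #(Fintype.piFinset fun x => if x ∈ P then {g x} else univ) = q ^ #Pᶜ := by
    simp [Fintype.card_piFinset, apply_ite card, prod_ite, filter_not, compl_eq_univ_sdiff]
  calc Fintype.card (V → Fin q) = q ^ #P * q ^ #Pᶜ := by
        rw [← pow_add, card_add_card_compl, Fintype.card_fun, Fintype.card_fin]
    _ ≤ q ^ q * #{χ : V → Fin q | Set.InjOn χ P} :=
        Nat.mul_le_mul (Nat.pow_le_pow_right hq hP) (hcard ▸ card_le_card hsub)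

open Classical in
theorem exists_rainbow_colouring [Finite V] {q : ℕ} (hq : 0 < q) {W : Finset V}
    {P : V → Finset V} (hP : ∀ x ∈ W, #(P x) ≤ q) :
    ∃ χ : V → Fin q, #W ≤ q ^ q * #{x ∈ W | Set.InjOn χ (P x)} := by
  have := Fintype.ofFinite V
  have hne : (univ : Finset (V → Fin q)).Nonempty := ⟨fun _ => ⟨0, hq⟩, mem_univ _⟩
  obtain ⟨χ, -, hχ⟩ := exists_card_le_mul_card_filter hne W (fun χ x => Set.InjOn χ (P x))
    fun x hx => card_colourings_le_mul_card_injOn hq (hP x hx)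
  exact ⟨χ, hχ⟩

end Colouring

section Chain

theorem exists_chain_or_colouring {α : Type*} (R : α → α → Prop) (N : ℕ) :
    (∃ x : ℕ → α, ∀ i < N, R (x i) (x (i + 1))) ∨ ∃ c : α → Fin N, ∀ a b, R a b → c a < c b := by
  classical
  rw [or_iff_not_imp_left]
  intro hno
  let EndOfChain (a : α) (s : ℕ) : Prop :=
    ∃ x : ℕ → α, (∀ i < s, R (x i) (x (i + 1))) ∧ x s = a
  let height (a : α) : ℕ := Nat.findGreatest (EndOfChain a) N
  have hend : ∀ a, EndOfChain a (height a) := fun a =>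
    Nat.findGreatest_spec (Nat.zero_le N) ⟨fun _ => a, by simp, rfl⟩
  have hlt : ∀ a, height a < N := fun a =>
    (Nat.findGreatest_le N).lt_of_ne fun h =>
      let ⟨x, hx, _⟩ := hend a
      hno ⟨x, fun i hi => hx i (hi.trans_eq h.symm)⟩
  refine ⟨fun a => ⟨height a, hlt a⟩, fun a b hab => ?_⟩
  obtain ⟨x, hx, hxa⟩ := hend a
  suffices hb : EndOfChain b (height a + 1) from Nat.le_findGreatest (hlt a) hb
  refine ⟨update x (height a + 1) b, fun i hi => ?_, update_self ..⟩
  rcases (Nat.lt_succ_iff.1 hi).eq_or_lt with rfl | hi'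
  · rwa [update_self, update_of_ne (Nat.succ_ne_self _).symm, hxa]
  · rw [update_of_ne (by omega), update_of_ne (by omega)]
    exact hx i hi'

theorem eq_of_cmp_eq {α : Type*} [LinearOrder α] {y : ℕ → α} {N : ℕ} {o : Ordering}
    (h : ∀ i < N, cmp (y i) (y (i + 1)) = o) {s t : ℕ} (hs : s ≤ N) (ht : t ≤ N) (hst : s ≠ t)
    (heq : y s = y t) : ∀ i ≤ N, y i = y s := by
  cases o with
  | lt =>
    have hmono : StrictMonoOn y (Set.Iic N) :=
      strictMonoOn_Iic_of_lt_succ fun i hi => (cmp_eq_lt_iff _ _).1 (h i hi)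
    exact absurd (hmono.injOn hs ht heq) hst
  | gt =>
    have hanti : StrictAntiOn y (Set.Iic N) :=
      strictAntiOn_Iic_of_succ_lt fun i hi => (cmp_eq_gt_iff _ _).1 (h i hi)
    exact absurd (hanti.injOn hs ht heq) hst
  | eq =>
    have hzero : ∀ i ≤ N, y i = y 0 := fun i => by
      induction i with
      | zero => exact fun _ => rfl
      | succ i ih => exact fun hi => ((cmp_eq_eq_iff _ _).1 (h i hi)).symm.trans (ih (by omega))
    exact fun i hi => (hzero i hi).trans (hzero s hs).symm

variable {V : Type*} [LinearOrder V] {F : Finset (Finset V)} {W : Finset V}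

/-- `a < b` are the smallest and the largest vertex of an edge of `F` inside `W`. -/
def IsMonotoneEdge (F : Finset (Finset V)) (W : Finset V) (a b : V) : Prop :=
  a < b ∧ ∃ e ∈ F, e ⊆ W ∧ IsLeast (e : Set V) a ∧ IsGreatest (e : Set V) b

theorem exists_monotoneChain_or_indep {T : Type*} [Fintype T] (hF : ∀ e ∈ F, 2 ≤ #e)
    (W : Finset V) (τ : V → V → T) {N : ℕ} (hN : 0 < N) :
    (∃ (σ : T) (x : ℕ → V), ∀ i < N,
      IsMonotoneEdge F W (x i) (x (i + 1)) ∧ τ (x i) (x (i + 1)) = σ) ∨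
    ∃ I ⊆ W, IsIndep F I ∧ #W ≤ N ^ Fintype.card T * #I := by
  classical
  rw [or_iff_not_imp_left]
  intro hno
  have hcol : ∀ σ, ∃ c : V → Fin N, ∀ a b, IsMonotoneEdge F W a b ∧ τ a b = σ → c a < c b :=
    fun σ => (exists_chain_or_colouring _ N).resolve_left fun ⟨x, hx⟩ => hno ⟨σ, x, hx⟩
  choose c hc using hcol
  have : NeZero N := ⟨hN.ne'⟩
  obtain ⟨p, hp⟩ := exists_card_le_mul_card_fiber W fun x σ => c σ x
  refine ⟨_, filter_subset _ _, fun e he heI => ?_, by simpa using hp⟩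
  have hne : e.Nonempty := card_pos.1 (zero_lt_two.trans_le (hF e he))
  have hedge : IsMonotoneEdge F W (e.min' hne) (e.max' hne) :=
    ⟨min'_lt_max'_of_card e (hF e he), e, he, heI.trans (filter_subset _ _),
      isLeast_min' e hne, isGreatest_max' e hne⟩
  have hmin : (fun σ => c σ (e.min' hne)) = p := (mem_filter.1 (heI (min'_mem e hne))).2
  have hmax : (fun σ => c σ (e.max' hne)) = p := (mem_filter.1 (heI (max'_mem e hne))).2
  exact (hc _ _ _ ⟨hedge, rfl⟩).ne (congrFun (hmin.trans hmax.symm) _)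

end Chain

section Cycle

variable {V : Type*} [DecidableEq V] {l : ℕ}

theorem eq_add_one_or_eq_sub_one_iff_val (hl : 2 ≤ l) {i j : ZMod l} (hij : i.val < j.val) :
    j = i + 1 ∨ j = i - 1 ↔ j.val = i.val + 1 ∨ i.val = 0 ∧ j.val + 1 = l := by
  have : NeZero l := ⟨by omega⟩
  have : Fact (1 < l) := ⟨hl⟩
  have hj := ZMod.val_lt j
  refine or_congr ?_ ?_
  · rw [← (ZMod.val_injective l).eq_iff, ZMod.val_add, ZMod.val_one, Nat.mod_eq_of_lt (by omega)]
  · rw [eq_sub_iff_add_eq, ← (ZMod.val_injective l).eq_iff, ZMod.val_add, ZMod.val_one]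
    rcases Nat.lt_or_ge (j.val + 1) l with h | h
    · rw [Nat.mod_eq_of_lt h]
      omega
    · rw [show j.val + 1 = l by omega, Nat.mod_self]
      omega

theorem isLooseCycle_of_nat (hl : 2 ≤ l) {g : ℕ → Finset V}
    (hg : ∀ i j, i < j → j < l → #(g i ∩ g j) = if j = i + 1 ∨ i = 0 ∧ j + 1 = l then 1 else 0) :
    IsLooseCycle fun i : ZMod l => g i.val := by
  have : NeZero l := ⟨by omega⟩
  have hlt : ∀ i j : ZMod l, i.val < j.val →
      if j = i + 1 ∨ j = i - 1 then #(g i.val ∩ g j.val) = 1 else g i.val ∩ g j.val = ∅ := by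
    intro i j hij
    have hcard := hg _ _ hij (ZMod.val_lt j)
    simp only [← eq_add_one_or_eq_sub_one_iff_val hl hij] at hcard
    split_ifs at hcard ⊢
    exacts [hcard, card_eq_zero.1 hcard]
  intro i j hij
  rcases Nat.lt_or_gt_of_ne fun h => hij (ZMod.val_injective l h) with h | h
  · exact hlt i j h
  · have hsymm : (j = i + 1 ∨ j = i - 1) ↔ (i = j + 1 ∨ i = j - 1) := by
      rw [eq_sub_iff_add_eq, eq_sub_iff_add_eq, or_comm, eq_comm (a := i), eq_comm (a := j)]
    simp only [hsymm, inter_comm (g i.val)]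
    exact hlt j i h

/-- In `g 0, …, g (n - 1)` consecutive sets share exactly one element and any other two are
disjoint. -/
def IsLooseChain (n : ℕ) (g : ℕ → Finset V) : Prop :=
  ∀ i j, i < j → j < n → #(g i ∩ g j) = if j = i + 1 then 1 else 0

theorem IsLooseChain.mono {n m : ℕ} {g : ℕ → Finset V} (hg : IsLooseChain n g) (hmn : m ≤ n) :
    IsLooseChain m g :=
  fun i j hij hj => hg i j hij (hj.trans_le hmn)

theorem hasLooseCycle_of_chains {t h : ℕ} (ht : 0 < t) (hh : 0 < h) {F : Finset (Finset V)}
    {p g g' : ℕ → Finset V} (hp : IsLooseChain t p) (hg : IsLooseChain h g)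
    (hg' : IsLooseChain h g') (hpF : ∀ i < t, p i ∈ F) (hgF : ∀ b < h, g b ∈ F)
    (hgF' : ∀ b < h, g' b ∈ F)
    (hpg : ∀ i < t, ∀ b < h, #(p i ∩ g b) = if i = 0 ∧ b = 0 then 1 else 0)
    (hpg' : ∀ i < t, ∀ b < h, #(p i ∩ g' b) = if i + 1 = t ∧ b = 0 then 1 else 0)
    (hgg' : ∀ b < h, ∀ b' < h, #(g b ∩ g' b') = if b + 1 = h ∧ b' + 1 = h then 1 else 0) :
    HasLooseCycle F (t + 2 * h) := by
  have : NeZero (t + 2 * h) := ⟨by omega⟩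
  let G (i : ℕ) : Finset V :=
    if i < t then p i else if i < t + h then g' (i - t) else g (t + 2 * h - 1 - i)
  have hGp : ∀ i < t, G i = p i := fun i hi => if_pos hi
  have hGg' : ∀ i, t ≤ i → i < t + h → G i = g' (i - t) := fun i hi hi' =>
    (if_neg hi.not_gt).trans (if_pos hi')
  have hGg : ∀ i, t + h ≤ i → G i = g (t + 2 * h - 1 - i) := fun i hi =>
    (if_neg (by omega)).trans (if_neg hi.not_gt)
  have hsplit : ∀ i, i < t ∨ t ≤ i ∧ i < t + h ∨ t + h ≤ i := fun i => by omega
  refine ⟨fun i => G i.val, isLooseCycle_of_nat (by omega) fun i j hij hj => ?_, fun i => ?_⟩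
  · rcases hsplit i with hi | ⟨hi, hi'⟩ | hi <;> rcases hsplit j with hj' | ⟨hj', hj''⟩ | hj' <;>
      try omega
    · rw [hGp i hi, hGp j hj', hp i j hij hj']
      exact if_congr (by omega) rfl rfl
    · rw [hGp i hi, hGg' j hj' hj'', hpg' i hi _ (by omega)]
      exact if_congr (by omega) rfl rfl
    · rw [hGp i hi, hGg j hj', hpg i hi _ (by omega)]
      exact if_congr (by omega) rfl rfl
    · rw [hGg' i hi hi', hGg' j hj' hj'', hg' _ _ (by omega) (by omega)]
      exact if_congr (by omega) rfl rfl
    · rw [hGg' i hi hi', hGg j hj', inter_comm, hgg' _ (by omega) _ (by omega)]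
      exact if_congr (by omega) rfl rfl
    · rw [hGg i hi, hGg j hj', inter_comm, hg _ _ (by omega) (by omega)]
      exact if_congr (by omega) rfl rfl
  · have hi := ZMod.val_lt i
    change G i.val ∈ F
    rcases hsplit i.val with h | ⟨h, h'⟩ | h
    · exact hGp _ h ▸ hpF _ h
    · exact hGg' _ h h' ▸ hgF' _ (by omega)
    · exact hGg _ h ▸ hgF _ (by omega)

theorem isLooseChain_of_isLeast_isGreatest {V : Type*} [LinearOrder V] {n : ℕ} {e : ℕ → Finset V}
    {x : ℕ → V} (hx : StrictMonoOn x (Set.Iic n)) (hmin : ∀ i < n, IsLeast (e i : Set V) (x i))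
    (hmax : ∀ i < n, IsGreatest (e i : Set V) (x (i + 1))) : IsLooseChain n e := by
  intro i j hij hj
  split_ifs with h
  · subst h
    refine card_eq_one.2 ⟨x (i + 1), eq_singleton_iff_unique_mem.2
      ⟨mem_inter.2 ⟨(hmax i (by omega)).1, (hmin _ hj).1⟩, fun z hz => ?_⟩⟩
    obtain ⟨hzi, hzj⟩ := mem_inter.1 hz
    exact ((hmax i (by omega)).2 hzi).antisymm ((hmin _ hj).2 hzj)
  · refine card_eq_zero.2 (disjoint_iff_inter_eq_empty.1 (disjoint_left.2 fun z hzi hzj => ?_))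
    have hlt : x (i + 1) < x j := hx (Set.mem_Iic.2 (by omega)) (Set.mem_Iic.2 hj.le) (by omega)
    exact (((hmin j hj).2 hzj).trans ((hmax i (by omega)).2 hzi)).not_gt hlt

end Cycle

section LoosePath

variable {V : Type*} [DecidableEq V] {F : Finset (Finset V)} {j r : ℕ} {v x y z : V}
  {g : ℕ → Finset V}

/-- The vertices of a path with the edges `g 0, …, g (j - 1)`. -/
def pathVertices (j : ℕ) (g : ℕ → Finset V) : Finset V := (range j).biUnion g

theorem mem_pathVertices : z ∈ pathVertices j g ↔ ∃ b < j, z ∈ g b := by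
  simp only [pathVertices, mem_biUnion, mem_range]

/-- `g 0, …, g (j - 1)` are the edges of a loose path in `F` from `x` to `v`. A path without edges
joins `v` to itself. -/
structure IsLoosePath (F : Finset (Finset V)) (j : ℕ) (v x : V) (g : ℕ → Finset V) : Prop where
  mem : ∀ b < j, g b ∈ F
  isLooseChain : IsLooseChain j g
  mem_iff : ∀ b < j, (x ∈ g b ↔ b = 0)
  root_mem : 0 < j → v ∈ g (j - 1)
  eq_root : j = 0 → x = v

theorem IsLoosePath.card_pathVertices_le (h : IsLoosePath F j v x g) (hF : ∀ e ∈ F, #e ≤ r) :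
    #(pathVertices j g) ≤ j * r :=
  (card_biUnion_le_card_mul _ _ r fun b hb => hF _ (h.mem b (mem_range.1 hb))).trans_eq
    (by rw [card_range])

theorem IsLoosePath.cons (h : IsLoosePath F j v y g) {e : Finset V} (he : e ∈ F) (hx : x ∈ e)
    (hy : y ∈ e) (hxy : x ≠ y) (hdisj : ∀ z ∈ pathVertices j g, z ∈ e → z = y) :
    ∃ g', IsLoosePath F (j + 1) v x g' := by
  have hinter : ∀ b < j, ∀ z ∈ g b, z ∈ e → z = y := fun b hb z hz =>
    hdisj z (mem_pathVertices.2 ⟨b, hb, hz⟩)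
  have hfirst : ∀ b < j, #(e ∩ g b) = if b = 0 then 1 else 0 := by
    intro b hb
    split_ifs with hb0
    · refine card_eq_one.2 ⟨y, eq_singleton_iff_unique_mem.2
        ⟨mem_inter.2 ⟨hy, (h.mem_iff b hb).2 hb0⟩, fun z hz => ?_⟩⟩
      exact hinter b hb z (mem_inter.1 hz).2 (mem_inter.1 hz).1
    · refine card_eq_zero.2 (disjoint_iff_inter_eq_empty.1 (disjoint_left.2 fun z hze hzb => ?_))
      obtain rfl := hinter b hb z hzb hze
      exact hb0 ((h.mem_iff b hb).1 hzb)
  refine ⟨fun | 0 => e | b + 1 => g b, ?_, ?_, ?_, fun _ => ?_, fun hj => absurd hj j.succ_ne_zero⟩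
  · rintro (_ | b) hb
    exacts [he, h.mem b (by omega)]
  · rintro (_ | i) (_ | b) hib hb
    · omega
    · exact (hfirst b (by omega)).trans (if_congr (by omega) rfl rfl)
    · omega
    · exact (h.isLooseChain i b (by omega) (by omega)).trans (if_congr (by omega) rfl rfl)
  · rintro (_ | b) hb
    · exact iff_of_true hx rfl
    · exact iff_of_false (fun hxb => hxy (hinter b (by omega) x hxb hx)) b.succ_ne_zero
  · rcases j with _ | j
    · exact h.eq_root rfl ▸ hy
    · exact h.root_mem j.succ_pos

end LoosePath

section Alignment

variable {V : Type*} [DecidableEq V] {j q : ℕ} {W : Finset V} {g : V → ℕ → Finset V}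

/-- Each of the paths `g x` with `j` edges, where `x ∈ W`, has vertices of different colours, and
edges at the same place in two of these paths carry the same colours, as do all vertices in `W`. -/
structure IsAligned (χ : V → Fin q) (j : ℕ) (g : V → ℕ → Finset V) (W : Finset V) : Prop where
  injOn : ∀ x ∈ W, Set.InjOn χ (pathVertices j (g x))
  color_eq : ∀ x ∈ W, ∀ y ∈ W, χ x = χ y
  image_eq : ∀ x ∈ W, ∀ y ∈ W, ∀ b < j, (g x b).image χ = (g y b).image χ

theorem exists_isAligned_subset [Finite V] (hq : 0 < q)
    (hg : ∀ x ∈ W, #(pathVertices j (g x)) ≤ q) :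
    ∃ χ : V → Fin q, ∃ W' ⊆ W, IsAligned χ j g W' ∧ #W ≤ q ^ q * ((2 ^ q) ^ j * q) * #W' := by
  classical
  have : Nonempty (Fin q) := ⟨⟨0, hq⟩⟩
  obtain ⟨χ, hχ⟩ := exists_rainbow_colouring hq hg
  set W₁ := {x ∈ W | Set.InjOn χ (pathVertices j (g x))}
  let pattern (x : V) : (Fin j → Finset (Fin q)) × Fin q := (fun b => (g x b).image χ, χ x)
  obtain ⟨π, hπ⟩ := exists_card_le_mul_card_fiber W₁ pattern
  have hpattern : ∀ x ∈ ({x ∈ W₁ | pattern x = π} : Finset V),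
      ∀ y ∈ ({x ∈ W₁ | pattern x = π} : Finset V), pattern x = pattern y := fun x hx y hy =>
    (mem_filter.1 hx).2.trans (mem_filter.1 hy).2.symm
  refine ⟨χ, {x ∈ W₁ | pattern x = π}, (filter_subset _ _).trans (filter_subset _ _),
    ⟨fun x hx => (mem_filter.1 (mem_filter.1 hx).1).2,
      fun x hx y hy => congrArg Prod.snd (hpattern x hx y hy),
      fun x hx y hy b hb => congrFun (congrArg Prod.fst (hpattern x hx y hy)) ⟨b, hb⟩⟩, ?_⟩
  rw [Fintype.card_prod, Fintype.card_fun, Fintype.card_finset, Fintype.card_fin,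
    Fintype.card_fin] at hπ
  rw [mul_assoc]
  exact hχ.trans (Nat.mul_le_mul_left _ hπ)

end Alignment

section Sunflower

variable {V : Type*} [LinearOrder V] {F : Finset (Finset V)} {W : Finset V} {N j D : ℕ} {v : V}
  {x : ℕ → V} {g : ℕ → ℕ → Finset V}

/-- The loose paths `g s`, where `s ≤ N`, join distinct vertices `x s` of `W` to `v`, contain no
other vertex of `W`, and whatever two of them share lies on all of them, at the same place. -/
structure IsPathSunflower (F : Finset (Finset V)) (W : Finset V) (N j : ℕ) (v : V) (x : ℕ → V)
    (g : ℕ → ℕ → Finset V) : Prop where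
  isLoosePath : ∀ s ≤ N, IsLoosePath F j v (x s) (g s)
  mem : ∀ s ≤ N, x s ∈ W
  injOn : Set.InjOn x (Set.Iic N)
  eq_of_mem : ∀ s ≤ N, ∀ b < j, ∀ z ∈ g s b, z ∈ W → z = x s
  inter_subset : ∀ s ≤ N, ∀ t ≤ N, s ≠ t → ∀ b < j, ∀ b' < j, ∀ u ≤ N, g s b ∩ g t b' ⊆ g u b

theorem isPathSunflower_of_isAligned [Nonempty V] {q : ℕ} {χ : V → Fin q} {p : V → ℕ → Finset V}
    (hp : IsAligned χ j p W) (hj : 0 < j) (hpath : ∀ y ∈ W, IsLoosePath F j v y (p y))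
    (hx : ∀ s ≤ N, x s ∈ W) (hinj : Set.InjOn x (Set.Iic N)) {σ : Fin q → Ordering}
    (hσ : ∀ c, ∀ s < N, cmp (invFunOn χ (pathVertices j (p (x s))) c)
      (invFunOn χ (pathVertices j (p (x (s + 1)))) c) = σ c) :
    IsPathSunflower F W N j v x fun s => p (x s) := by
  have hinv : ∀ s ≤ N, ∀ b < j, ∀ z ∈ p (x s) b,
      invFunOn χ (pathVertices j (p (x s))) (χ z) = z := fun s hs b hb z hz =>
    (hp.injOn _ (hx s hs)).leftInvOn_invFunOn (mem_pathVertices.2 ⟨b, hb, hz⟩)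
  refine ⟨fun s hs => hpath _ (hx s hs), hx, hinj, fun s hs b hb z hz hzW => ?_,
    fun s hs t ht hst b hb b' hb' u hu z hz => ?_⟩
  · have hxs : x s ∈ p (x s) 0 := ((hpath _ (hx s hs)).mem_iff 0 hj).2 rfl
    exact hp.injOn _ (hx s hs) (mem_pathVertices.2 ⟨b, hb, hz⟩) (mem_pathVertices.2 ⟨0, hj, hxs⟩)
      (hp.color_eq _ hzW _ (hx s hs))
  · obtain ⟨hzs, hzt⟩ := mem_inter.1 hz
    have hzu : invFunOn χ (pathVertices j (p (x u))) (χ z) = z :=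
      (eq_of_cmp_eq (hσ (χ z)) hs ht hst
        ((hinv s hs b hb z hzs).trans (hinv t ht b' hb' z hzt).symm) u hu).trans
        (hinv s hs b hb z hzs)
    obtain ⟨w, hw, hwz⟩ : ∃ w ∈ p (x u) b, χ w = χ z := by
      rw [← mem_image, hp.image_eq _ (hx u hu) _ (hx s hs) b hb]
      exact mem_image_of_mem χ hzs
    rwa [← hzu, ← hwz, hinv u hu b hb w hw]

namespace IsPathSunflower

theorem injOn_edge (h : IsPathSunflower F W N j v x g) {a : ℕ} (ha : a < j)
    (hdisj : ∀ b < a, ∀ s ≤ N, ∀ t ≤ N, s ≠ t → Disjoint (g s b) (g t a)) :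
    Set.InjOn (fun s => g s a) (Set.Iic N) := by
  intro s hs t ht (hst : g s a = g t a)
  by_contra hne
  rcases a.eq_zero_or_pos with rfl | ha0
  · have hxs : x s ∈ g t 0 := hst ▸ ((h.isLoosePath s hs).mem_iff 0 ha).2 rfl
    exact hne (h.injOn hs ht (h.eq_of_mem t ht 0 ha _ hxs (h.mem s hs)))
  · have hcard := (h.isLoosePath s hs).isLooseChain (a - 1) a (by omega) ha
    rw [if_pos (by omega)] at hcard
    obtain ⟨y, hy⟩ := card_pos.1 (hcard.ge : 0 < #(g s (a - 1) ∩ g s a))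
    obtain ⟨hy, hy'⟩ := mem_inter.1 hy
    exact disjoint_left.1 (hdisj _ (by omega) s hs t ht hne) hy (hst ▸ hy')

theorem card_inter_le_one (h : IsPathSunflower F W N j v x g) (hDN : D ≤ N)
    (hD : ∀ y z, y ≠ z → #{e ∈ F | y ∈ e ∧ z ∈ e} ≤ D) {a : ℕ} (ha : a < j)
    (hinj : Set.InjOn (fun s => g s a) (Set.Iic N)) {s t : ℕ} (hs : s ≤ N) (ht : t ≤ N)
    (hst : s ≠ t) : #(g s a ∩ g t a) ≤ 1 := by
  by_contra! hlt
  obtain ⟨y, hy, z, hz, hyz⟩ := one_lt_card.1 hlt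
  have hmaps : ∀ u ∈ Finset.Iic N, g u a ∈ ({e ∈ F | y ∈ e ∧ z ∈ e} : Finset _) := fun u hu =>
    have hu := Finset.mem_Iic.1 hu
    mem_filter.2 ⟨(h.isLoosePath u hu).mem a ha, h.inter_subset s hs t ht hst a ha a ha u hu hy,
      h.inter_subset s hs t ht hst a ha a ha u hu hz⟩
  have hcard := card_le_card_of_injOn _ hmaps (by rwa [coe_Iic])
  rw [Nat.card_Iic] at hcard
  have := hD y z hyz
  omega

theorem exists_meeting_index (h : IsPathSunflower F W N j v x g) (hj : 0 < j) (hDN : D ≤ N)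
    (hD : ∀ y z, y ≠ z → #{e ∈ F | y ∈ e ∧ z ∈ e} ≤ D) :
    ∃ a < j, ∀ s ≤ N, ∀ t ≤ N, s ≠ t → ∀ b ≤ a, ∀ b' ≤ a,
      #(g s b ∩ g t b') = if b = a ∧ b' = a then 1 else 0 := by
  classical
  have hroot : ∃ b < j, ∃ z, ∀ u ≤ N, z ∈ g u b :=
    ⟨j - 1, by omega, v, fun u hu => (h.isLoosePath u hu).root_mem hj⟩
  set a := Nat.find hroot
  obtain ⟨haj, w, hw⟩ := Nat.find_spec hroot
  have hdisj : ∀ b < a, ∀ b' ≤ a, ∀ s ≤ N, ∀ t ≤ N, s ≠ t → Disjoint (g s b) (g t b') :=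
    fun b hb b' hb' s hs t ht hst => disjoint_left.2 fun z hz hz' =>
      Nat.find_min hroot hb ⟨hb.trans haj, z, fun u hu =>
        h.inter_subset s hs t ht hst b (hb.trans haj) b' (hb'.trans_lt haj) u hu
          (mem_inter.2 ⟨hz, hz'⟩)⟩
  have hinj := h.injOn_edge haj fun b hb => hdisj b hb a le_rfl
  refine ⟨a, haj, fun s hs t ht hst b hb b' hb' => ?_⟩
  split_ifs with hbb
  · obtain ⟨rfl, rfl⟩ := hbb
    exact (h.card_inter_le_one hDN hD haj hinj hs ht hst).antisymm
      (card_pos.2 ⟨w, mem_inter.2 ⟨hw s hs, hw t ht⟩⟩)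
  · rw [card_eq_zero, ← disjoint_iff_inter_eq_empty]
    rcases hb.lt_or_eq with hlt | rfl
    · exact hdisj b hlt b' hb' s hs t ht hst
    · exact (hdisj b' (by omega) _ hb t ht s hs hst.symm).symm

theorem card_inter_path (h : IsPathSunflower F W N j v x g) {e : Finset V} (he : e ⊆ W) {s b : ℕ}
    (hs : s ≤ N) (hb : b < j) : #(e ∩ g s b) = if x s ∈ e ∧ b = 0 then 1 else 0 := by
  have heq : ∀ z ∈ e ∩ g s b, z = x s := fun z hz =>
    h.eq_of_mem s hs b hb z (mem_inter.1 hz).2 (he (mem_inter.1 hz).1)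
  split_ifs with hc
  · exact card_eq_one.2 ⟨x s, eq_singleton_iff_unique_mem.2
      ⟨mem_inter.2 ⟨hc.1, ((h.isLoosePath s hs).mem_iff b hb).2 hc.2⟩, heq⟩⟩
  · refine card_eq_zero.2 (eq_empty_of_forall_notMem fun z hz => hc ?_)
    obtain rfl := heq z hz
    exact ⟨(mem_inter.1 hz).1, ((h.isLoosePath s hs).mem_iff b hb).1 (mem_inter.1 hz).2⟩

theorem hasLooseCycle {k : ℕ} (h : IsPathSunflower F W N j v x g)
    (hx : ∀ i < N, IsMonotoneEdge F W (x i) (x (i + 1))) (hj : 0 < j) (hjk : j ≤ k)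
    (hkN : 2 * k ≤ N) (hDN : D ≤ N) (hD : ∀ y z, y ≠ z → #{e ∈ F | y ∈ e ∧ z ∈ e} ≤ D) :
    HasLooseCycle F (2 * k + 1) := by
  obtain ⟨a, haj, hmeet⟩ := h.exists_meeting_index hj hDN hD
  obtain ⟨t, ht⟩ : ∃ t, t + 2 * (a + 1) = 2 * k + 1 := ⟨2 * k + 1 - 2 * (a + 1), by omega⟩
  have hmono : StrictMonoOn x (Set.Iic N) := strictMonoOn_Iic_of_lt_succ fun i hi => (hx i hi).1
  have hedge : ∀ i < N, ∃ e ∈ F, e ⊆ W ∧ IsLeast (e : Set V) (x i) ∧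
      IsGreatest (e : Set V) (x (i + 1)) := fun i hi => (hx i hi).2
  choose! e heF heW hmin hmax using hedge
  have hmem : ∀ i < N, ∀ s ≤ N, x s ∈ e i ↔ s = i ∨ s = i + 1 := by
    refine fun i hi s hs => ⟨fun hse => ?_, ?_⟩
    · have hle := (hmono.le_iff_le (Set.mem_Iic.2 hi.le) hs).1 ((hmin i hi).2 hse)
      have hge := (hmono.le_iff_le hs (Set.mem_Iic.2 hi)).1 ((hmax i hi).2 hse)
      omega
    · rintro (rfl | rfl)
      exacts [(hmin s hi).1, (hmax i hi).1]
  have hchain : IsLooseChain N e := isLooseChain_of_isLeast_isGreatest hmono hmin hmax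
  rw [← ht]
  refine hasLooseCycle_of_chains (by omega) a.succ_pos (hchain.mono (by omega))
    ((h.isLoosePath 0 (by omega)).isLooseChain.mono haj)
    ((h.isLoosePath t (by omega)).isLooseChain.mono haj) (fun i hi => heF i (by omega))
    (fun b hb => (h.isLoosePath 0 (by omega)).mem b (by omega))
    (fun b hb => (h.isLoosePath t (by omega)).mem b (by omega)) ?_ ?_ ?_
  · intro i hi b hb
    rw [h.card_inter_path (heW i (by omega)) (by omega) (by omega)]
    exact if_congr (by rw [hmem i (by omega) 0 (by omega)]; omega) rfl rfl
  · intro i hi b hb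
    rw [h.card_inter_path (heW i (by omega)) (by omega) (by omega)]
    exact if_congr (by rw [hmem i (by omega) t (by omega)]; omega) rfl rfl
  · intro b hb b' hb'
    rw [hmeet 0 (by omega) t (by omega) (by omega) b (by omega) b' (by omega)]
    exact if_congr (by omega) rfl rfl

end IsPathSunflower

/-- A bound for the number of path ends per vertex of the independent set that
`exists_indep_of_loosePaths` finds among them. The three factors account for the paths that are not
rainbow, for the colour patterns of the others, and for the classes of
`exists_monotoneChain_or_indep`. -/
def indepConst (r D k : ℕ) : ℕ :=
  (k * r) ^ (k * r) * ((2 ^ (k * r)) ^ k * (k * r)) * (2 * k + D) ^ 3 ^ (k * r)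

theorem indepConst_pos {r k : ℕ} (hr : 0 < r) (hk : 0 < k) (D : ℕ) : 0 < indepConst r D k := by
  unfold indepConst
  positivity

theorem exists_indep_of_loosePaths [Finite V] {r k : ℕ} (hF : IsSparse F r D) (hr : 0 < r)
    (hj : 0 < j) (hjk : j ≤ k) (hcycle : ¬ HasLooseCycle F (2 * k + 1))
    (hW : ∀ y ∈ W, ∃ p, IsLoosePath F j v y p) :
    ∃ I ⊆ W, IsIndep F I ∧ #W ≤ indepConst r D k * #I := by
  have : Nonempty V := ⟨v⟩
  choose! p hp using hW
  have hcard : ∀ y ∈ W, #(pathVertices j (p y)) ≤ k * r := fun y hy =>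
    ((hp y hy).card_pathVertices_le hF.card_le).trans (Nat.mul_le_mul_right r hjk)
  obtain ⟨χ, W', hW', hχ, hWW'⟩ :=
    exists_isAligned_subset (Nat.mul_pos (hj.trans_le hjk) hr) hcard
  rcases exists_monotoneChain_or_indep hF.two_le_card W'
    (fun y z c => cmp (invFunOn χ (pathVertices j (p y)) c) (invFunOn χ (pathVertices j (p z)) c))
    (N := 2 * k + D) (by omega) with ⟨σ, x, hx⟩ | ⟨I, hIW', hI, hW'I⟩
  · have hmono := strictMonoOn_Iic_of_lt_succ fun i hi => (hx i hi).1.1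
    have hxW' : ∀ s ≤ 2 * k + D, x s ∈ W' := by
      rintro (_ | s) hs
      · obtain ⟨-, e, -, he, hmin, -⟩ := (hx 0 (by omega)).1
        exact he hmin.1
      · obtain ⟨-, e, -, he, -, hmax⟩ := (hx s hs).1
        exact he hmax.1
    have hsun := isPathSunflower_of_isAligned hχ hj (fun y hy => hp y (hW' hy)) hxW' hmono.injOn
      fun c i hi => congrFun (hx i hi).2 c
    exact absurd (hsun.hasLooseCycle (fun i hi => (hx i hi).1) hj hjk (by omega)
      (Nat.le_add_left D _) hF.codegree_le) hcycle
  · have hT : Fintype.card (Fin (k * r) → Ordering) = 3 ^ (k * r) := by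
      rw [Fintype.card_fun, Fintype.card_fin]
      rfl
    rw [hT] at hW'I
    refine ⟨I, hIW'.trans hW', hI, hWW'.trans ?_⟩
    rw [indepConst, mul_assoc _ _ #I]
    gcongr
    exact Nat.one_le_two_pow

end Sunflower

section Growth

variable {V : Type*} [DecidableEq V] {F : Finset (Finset V)} {r D j k : ℕ} {v x : V}
  {I U W : Finset V} {lam : ℝ}

/-- The vertices of the edges of `F` that meet `W`. -/
def nbhd (F : Finset (Finset V)) (W : Finset V) : Finset V := {e ∈ F | ¬ Disjoint e W}.biUnion id

theorem mem_nbhd : x ∈ nbhd F W ↔ ∃ e ∈ F, (∃ y ∈ e, y ∈ W) ∧ x ∈ e := by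
  simp only [nbhd, mem_biUnion, mem_filter, not_disjoint_iff, id, and_assoc]

theorem nbhd_subset_nbhd (hIW : I ⊆ W) : nbhd F I ⊆ nbhd F W := fun _ hx =>
  let ⟨e, he, ⟨y, hye, hyI⟩, hxe⟩ := mem_nbhd.1 hx
  mem_nbhd.2 ⟨e, he, ⟨y, hye, hIW hyI⟩, hxe⟩

/-- The vertices that an edge through `x` can contain without extending the path with the edges
`g 0, …, g (j - 1)` from `x`: `x` itself and the vertices of the edges in `F` that contain `x` and
another vertex of the path. -/
def blockedVertices (F : Finset (Finset V)) (j : ℕ) (x : V) (g : ℕ → Finset V) : Finset V :=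
  insert x (((pathVertices j g).erase x).biUnion fun z => {e ∈ F | x ∈ e ∧ z ∈ e}.biUnion id)

theorem card_blockedVertices_le (hF : IsSparse F r D) {g : ℕ → Finset V}
    (hg : IsLoosePath F j v x g) : #(blockedVertices F j x g) ≤ j * r * (D * r) + 1 := by
  have hpath : #((pathVertices j g).erase x) ≤ j * r :=
    (card_le_card (erase_subset _ _)).trans (hg.card_pathVertices_le hF.card_le)
  have hedges : ∀ z ∈ (pathVertices j g).erase x, #({e ∈ F | x ∈ e ∧ z ∈ e}.biUnion id) ≤ D * r :=
    fun z hz => (card_biUnion_le_card_mul _ _ r fun e he => hF.card_le e (mem_filter.1 he).1).trans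
      (Nat.mul_le_mul_right r (hF.codegree_le x z (ne_of_mem_erase hz).symm))
  exact (card_insert_le _ _).trans <| Nat.add_le_add_right
    ((card_biUnion_le_card_mul _ _ _ hedges).trans (Nat.mul_le_mul_right _ hpath)) 1

section PathEnds

variable [Fintype V]

open Classical in
/-- The ends of the loose paths in `F` with `j` edges from `v`. -/
noncomputable def pathEnds (F : Finset (Finset V)) (j : ℕ) (v : V) : Finset V :=
  {x | ∃ g, IsLoosePath F j v x g}

theorem mem_pathEnds : x ∈ pathEnds F j v ↔ ∃ g, IsLoosePath F j v x g := by
  simp only [pathEnds, mem_filter, mem_univ, true_and]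

theorem pathEnds_zero : pathEnds F 0 v = {v} := by
  ext x
  rw [mem_pathEnds, mem_singleton]
  refine ⟨fun ⟨g, hg⟩ => hg.eq_root rfl, ?_⟩
  rintro rfl
  exact ⟨fun _ => ∅, by simp, by simp [IsLooseChain], by simp, by simp, fun _ => rfl⟩

theorem pathEnds_subset (hF : ∀ e ∈ F, e ⊆ U) (hv : v ∈ U) : pathEnds F j v ⊆ U := by
  intro x hx
  obtain ⟨g, hg⟩ := mem_pathEnds.1 hx
  rcases j.eq_zero_or_pos with hj | hj
  · exact hg.eq_root hj ▸ hv
  · exact hF _ (hg.mem 0 hj) ((hg.mem_iff 0 hj).2 rfl)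

theorem nbhd_pathEnds_subset {g : V → ℕ → Finset V}
    (hg : ∀ y ∈ pathEnds F j v, IsLoosePath F j v y (g y)) :
    nbhd F (pathEnds F j v) ⊆ pathEnds F (j + 1) v ∪
      (pathEnds F j v).biUnion fun y => blockedVertices F j y (g y) := by
  intro x hx
  obtain ⟨e, he, ⟨y, hye, hy⟩, hxe⟩ := mem_nbhd.1 hx
  rw [mem_union, or_iff_not_imp_right]
  intro hblocked
  replace hblocked : x ∉ blockedVertices F j y (g y) := fun h =>
    hblocked (mem_biUnion.2 ⟨y, hy, h⟩)
  refine mem_pathEnds.2 ((hg y hy).cons he hxe hye (fun h => hblocked ?_) fun z hz hze =>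
    by_contra fun hzy => hblocked ?_)
  · exact h ▸ mem_insert_self _ _
  · exact mem_insert_of_mem (mem_biUnion.2 ⟨z, mem_erase.2 ⟨hzy, hz⟩,
      mem_biUnion.2 ⟨e, mem_filter.2 ⟨he, hye, hze⟩, hxe⟩⟩)

theorem card_nbhd_pathEnds_le (hF : IsSparse F r D) :
    #(nbhd F (pathEnds F j v)) ≤
      #(pathEnds F (j + 1) v) + #(pathEnds F j v) * (j * r * (D * r) + 1) := by
  have hpath : ∀ y ∈ pathEnds F j v, ∃ g, IsLoosePath F j v y g := fun y hy => mem_pathEnds.1 hy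
  choose! g hg using hpath
  calc #(nbhd F (pathEnds F j v))
      ≤ #(pathEnds F (j + 1) v) +
          #((pathEnds F j v).biUnion fun y => blockedVertices F j y (g y)) :=
        (card_le_card (nbhd_pathEnds_subset hg)).trans (card_union_le _ _)
    _ ≤ _ := Nat.add_le_add_left (card_biUnion_le_card_mul _ _ _ fun y hy =>
        card_blockedVertices_le hF (hg y hy)) _

theorem exists_indep_subset_pathEnds (hF : IsSparse F r D) (hr : 0 < r) (hk : 0 < k) (hjk : j ≤ k)
    (hcycle : ¬ HasLooseCycle F (2 * k + 1)) (v : V) :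
    ∃ I ⊆ pathEnds F j v, IsIndep F I ∧ #(pathEnds F j v) ≤ indepConst r D k * #I := by
  rcases j.eq_zero_or_pos with rfl | hj
  · refine ⟨{v}, pathEnds_zero.ge, fun e he hev => ?_, ?_⟩
    · exact ((hF.two_le_card e he).trans (card_le_card hev)).not_gt (by simp)
    · rw [pathEnds_zero]
      exact Nat.le_mul_of_pos_left _ (indepConst_pos hr hk D)
  · obtain ⟨_, -⟩ := exists_wellFoundedLT V
    obtain rfl := Subsingleton.elim ‹DecidableEq V› LinearOrder.toDecidableEq
    exact exists_indep_of_loosePaths hF hr hj hjk hcycle fun y hy => mem_pathEnds.1 hy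

end PathEnds

theorem exists_le_mul_of_le_pow {R : Type*} [Semiring R] [LinearOrder R] [IsStrictOrderedRing R]
    {w : ℕ → R} {c : R} (hc : 0 ≤ c) (h0 : 0 < w 0) (hk : 0 < k) (hw : w k ≤ c ^ k * w 0) :
    ∃ j < k, 0 < w j ∧ w (j + 1) ≤ c * w j := by
  by_contra! h
  have hlt : ∀ j < k, c ^ (j + 1) * w 0 < w (j + 1) := by
    intro j
    induction j with
    | zero => exact fun hj => by simpa using h 0 hj h0
    | succ j ih =>
      intro hj
      have hlt := ih (by omega)
      calc c ^ (j + 1 + 1) * w 0 = c * (c ^ (j + 1) * w 0) := by rw [pow_succ', mul_assoc]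
        _ ≤ c * w (j + 1) := mul_le_mul_of_nonneg_left hlt.le hc
        _ < w (j + 1 + 1) := h _ hj ((mul_nonneg (pow_nonneg hc _) h0.le).trans_lt hlt)
  obtain ⟨i, rfl⟩ := Nat.exists_eq_succ_of_ne_zero hk.ne'
  exact (hlt i i.lt_succ_self).not_ge hw

theorem exists_card_pathEnds_succ_le [Fintype V] (hF : IsSparse F r D) (hr : 0 < r) (hk : 0 < k)
    (hcycle : ¬ HasLooseCycle F (2 * k + 1)) (hlam : 0 ≤ lam)
    (hcard : ∀ I ⊆ pathEnds F k v, IsIndep F I → (#I : ℝ) ≤ lam ^ k) :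
    ∃ j < k, 0 < #(pathEnds F j v) ∧
      (#(pathEnds F (j + 1) v) : ℝ) ≤ indepConst r D k * lam * #(pathEnds F j v) := by
  have hC : (1 : ℝ) ≤ indepConst r D k := by exact_mod_cast indepConst_pos hr hk D
  obtain ⟨I, hI, hindep, hle⟩ := exists_indep_subset_pathEnds hF hr hk le_rfl hcycle v
  have hpow : (#(pathEnds F k v) : ℝ) ≤ (indepConst r D k * lam) ^ k :=
    calc (#(pathEnds F k v) : ℝ) ≤ indepConst r D k * #I := by exact_mod_cast hle
      _ ≤ indepConst r D k ^ k * lam ^ k := by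
        gcongr
        exacts [le_self_pow₀ hC hk.ne', hcard I hI hindep]
      _ = (indepConst r D k * lam) ^ k := (mul_pow _ _ _).symm
  obtain ⟨j, hj, hpos, hsucc⟩ := exists_le_mul_of_le_pow
    (w := fun j => (#(pathEnds F j v) : ℝ)) (c := indepConst r D k * lam) (by positivity)
    (by simp [pathEnds_zero]) hk (by simpa [pathEnds_zero] using hpow)
  exact ⟨j, hj, by exact_mod_cast hpos, hsucc⟩

/-- The factor of `lam * #I` that bounds the size of a neighbourhood in
`exists_indep_card_union_nbhd_le`. -/
noncomputable def expansionConst (r D k : ℕ) : ℝ :=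
  (indepConst r D k + (k * r * (D * r) + 2)) * indepConst r D k

theorem expansionConst_pos (hr : 0 < r) (hk : 0 < k) (D : ℕ) : 0 < expansionConst r D k := by
  have := indepConst_pos hr hk D
  unfold expansionConst
  positivity

theorem exists_indep_card_union_nbhd_le [Finite V] (hF : IsSparse F r D) (hr : 0 < r) (hk : 0 < k)
    (hcycle : ¬ HasLooseCycle F (2 * k + 1)) (hFU : ∀ e ∈ F, e ⊆ U) (hU : U.Nonempty)
    (hlam : 1 ≤ lam) (hcard : ∀ I ⊆ U, IsIndep F I → (#I : ℝ) ≤ lam ^ k) :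
    ∃ I ⊆ U, I.Nonempty ∧ IsIndep F I ∧
      (#(I ∪ nbhd F I) : ℝ) ≤ expansionConst r D k * lam * #I := by
  have := Fintype.ofFinite V
  obtain ⟨v, hv⟩ := hU
  obtain ⟨j, hjk, hpos, hsucc⟩ := exists_card_pathEnds_succ_le hF hr hk hcycle (by positivity)
    fun I hI => hcard I (hI.trans (pathEnds_subset hFU hv))
  obtain ⟨I, hI, hindep, hle⟩ := exists_indep_subset_pathEnds hF hr hk hjk.le hcycle v
  have hIpos : 0 < #I := pos_of_mul_pos_right (hpos.trans_le hle) (Nat.zero_le _)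
  have hunion : (#(I ∪ nbhd F I) : ℝ) ≤ #(pathEnds F j v) +
      (#(pathEnds F (j + 1) v) + #(pathEnds F j v) * (j * r * (D * r) + 1)) := by
    exact_mod_cast (card_le_card (union_subset_union hI (nbhd_subset_nbhd hI))).trans <|
      (card_union_le _ _).trans (Nat.add_le_add_left (card_nbhd_pathEnds_le hF) _)
  refine ⟨I, hI.trans (pathEnds_subset hFU hv), card_pos.1 hIpos, hindep, hunion.trans ?_⟩
  calc (#(pathEnds F j v) + (#(pathEnds F (j + 1) v) + #(pathEnds F j v) *
        (j * r * (D * r) + 1)) : ℝ)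
      ≤ (indepConst r D k * lam + (j * r * (D * r) + 2)) * #(pathEnds F j v) := by linarith
    _ ≤ (indepConst r D k * lam + (k * r * (D * r) + 2) * lam) * (indepConst r D k * #I) := by
        gcongr
        · exact (by gcongr : (j * r * (D * r) + 2 : ℝ) ≤ k * r * (D * r) + 2).trans
            (le_mul_of_one_le_right (by positivity) hlam)
        · exact_mod_cast hle
    _ = expansionConst r D k * lam * #I := by rw [expansionConst]; ring

theorem isIndep_filter_subset_iff (hI : I ⊆ U) : IsIndep {e ∈ F | e ⊆ U} I ↔ IsIndep F I :=
  ⟨fun h e he heI => h e (mem_filter.2 ⟨he, heI.trans hI⟩) heI,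
    fun h e he => h e (mem_filter.1 he).1⟩

theorem IsIndep.union {J : Finset V} (hI : IsIndep F I) (hJ : IsIndep F J)
    (hIJ : Disjoint J (nbhd F I)) : IsIndep F (I ∪ J) := by
  intro e he heIJ
  by_cases hdisj : Disjoint e I
  · exact hJ e he (hdisj.left_le_of_le_sup_left heIJ)
  · refine hI e he (Disjoint.left_le_of_le_sup_right heIJ (disjoint_left.2 fun y hye hyJ => ?_))
    exact disjoint_left.1 hIJ hyJ (mem_nbhd.2 ⟨e, he, not_disjoint_iff.1 hdisj, hye⟩)

theorem exists_indep_of_card_union_nbhd_le {c : ℝ} (hF : ∀ e ∈ F, e.Nonempty)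
    (h : ∀ U : Finset V, U.Nonempty → ∃ I ⊆ U, I.Nonempty ∧ IsIndep F I ∧
      (#(I ∪ nbhd {e ∈ F | e ⊆ U} I) : ℝ) ≤ c * #I) (U : Finset V) :
    ∃ I ⊆ U, IsIndep F I ∧ (#U : ℝ) ≤ c * #I := by
  induction U using Finset.strongInduction with
  | H U ih =>
    rcases U.eq_empty_or_nonempty with rfl | hU
    · exact ⟨∅, Subset.rfl, fun e he hsub => (hF e he).ne_empty (subset_empty.1 hsub), by simp⟩
    obtain ⟨I, hIU, ⟨y, hy⟩, hI, hcard⟩ := h U hU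
    set X := I ∪ nbhd {e ∈ F | e ⊆ U} I
    have hssub : U \ X ⊂ U := (ssubset_iff_of_subset sdiff_subset).2
      ⟨y, hIU hy, fun h => (mem_sdiff.1 h).2 (mem_union_left _ hy)⟩
    obtain ⟨J, hJ, hJindep, hJcard⟩ := ih _ hssub
    have hJX : Disjoint J X := disjoint_sdiff_self_left.mono_left hJ
    have hIJU : I ∪ J ⊆ U := union_subset hIU (hJ.trans sdiff_subset)
    refine ⟨I ∪ J, hIJU, ?_, ?_⟩
    · rw [← isIndep_filter_subset_iff hIJU]
      exact ((isIndep_filter_subset_iff hIU).2 hI).union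
        ((isIndep_filter_subset_iff (hJ.trans sdiff_subset)).2 hJindep)
        (hJX.mono_right subset_union_right)
    · rw [card_union_of_disjoint (hJX.mono_right subset_union_left).symm]
      have hUX : (#U : ℝ) ≤ #(U \ X) + #X := by exact_mod_cast card_le_card_sdiff_add_card
      push_cast
      linarith

theorem exists_indep_of_not_hasLooseCycle [Finite V] (hF : IsSparse F r D) (hr : 0 < r)
    (hk : 0 < k) (hcycle : ¬ HasLooseCycle F (2 * k + 1)) (hlam : 1 ≤ lam)
    (hcard : ∀ I, IsIndep F I → (#I : ℝ) ≤ lam ^ k) (U : Finset V) :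
    ∃ I ⊆ U, IsIndep F I ∧ (#U : ℝ) ≤ expansionConst r D k * lam * #I := by
  refine exists_indep_of_card_union_nbhd_le
    (fun e he => card_pos.1 (zero_lt_two.trans_le (hF.two_le_card e he))) (fun U hU => ?_) U
  obtain ⟨I, hIU, hIne, hI, hle⟩ := exists_indep_card_union_nbhd_le
    (hF.mono (filter_subset (· ⊆ U) F)) hr hk (fun h => hcycle (h.mono (filter_subset _ _)))
    (fun e he => (mem_filter.1 he).2) hU hlam
    fun I hIU hI => hcard I ((isIndep_filter_subset_iff hIU).1 hI)
  exact ⟨I, hIU, hIne, (isIndep_filter_subset_iff hIU).1 hI, hle⟩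

end Growth

section Ramsey

variable {V : Type*} [Fintype V] {r l n m k : ℕ} {χ : CompleteEdge V r → Color}

open Classical in
/-- The hypergraph of the edges to which `χ` gives the colour red. -/
noncomputable def redEdges (χ : CompleteEdge V r → Color) : Finset (Finset V) :=
  {e | ∃ h : #e = r, χ ⟨e, h⟩ = Color.red}

theorem mem_redEdges {e : Finset V} :
    e ∈ redEdges χ ↔ ∃ h : #e = r, χ ⟨e, h⟩ = Color.red := by
  simp [redEdges]

theorem card_of_mem_redEdges {e : Finset V} (he : e ∈ redEdges χ) : #e = r :=
  (mem_redEdges.1 he).1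

theorem HasLooseCycle.hasRedLooseCycle [DecidableEq V]
    (h : HasLooseCycle (redEdges χ) l) : HasRedLooseCycle l χ := by
  obtain ⟨e, he, hred⟩ := h
  choose hcard hred using fun i => mem_redEdges.1 (hred i)
  exact ⟨fun i => ⟨e i, hcard i⟩, he, hred⟩

theorem IsIndep.hasBlueClique {I : Finset V} (hI : IsIndep (redEdges χ) I) (hn : n ≤ #I) :
    HasBlueClique n χ := by
  obtain ⟨S, hSI, hS⟩ := exists_subset_card_eq hn
  refine ⟨S, hS, fun e heS => ?_⟩
  cases hc : χ e with
  | blue => rfl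
  | red => exact absurd (heS.trans hSI) (hI e (mem_redEdges.2 ⟨e.2, hc⟩))

theorem arrows_of_expansionConst_mul_le (hr : 2 ≤ r) (hk : 0 < k)
    (hm : expansionConst r (((2 * k + 1) * r) ^ r) k * (n : ℝ) ^ (1 + 1 / (k : ℝ)) ≤ m) :
    Arrows r (2 * k + 1) n m := by
  intro χ
  by_contra! ⟨hred, hblue⟩
  set M := (2 * k + 1) * r
  have hcard : ∀ e ∈ redEdges χ, #e = r := fun e => card_of_mem_redEdges
  have hindep : ∀ I, IsIndep (core (redEdges χ) M) I → #I < n := fun I hI =>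
    not_le.1 fun hn => hblue ((hI.of_core fun e he => (hcard e he).symm ▸ hr).hasBlueClique hn)
  have hcycle : ¬ HasLooseCycle (core (redEdges χ) M) (2 * k + 1) := fun h =>
    hred (h.of_core fun e he => (hcard e he).le).hasRedLooseCycle
  have hsparse : IsSparse (core (redEdges χ) M) r (M ^ r) :=
    isSparse_core (Nat.mul_pos (by lia) (by lia)) fun e he => (hcard e he).le
  have hempty : IsIndep (core (redEdges χ) M) ∅ := fun e he hsub => by
    simpa [subset_empty.1 hsub] using hsparse.two_le_card e he
  have hn : 0 < n := hindep ∅ hempty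
  have hlam : 1 ≤ (n : ℝ) ^ (1 / (k : ℝ)) :=
    Real.one_le_rpow (by exact_mod_cast hn) (by positivity)
  have hpow : ((n : ℝ) ^ (1 / (k : ℝ))) ^ k = n := by
    rw [one_div, Real.rpow_inv_natCast_pow n.cast_nonneg hk.ne']
  obtain ⟨I, -, hI, hle⟩ := exists_indep_of_not_hasLooseCycle hsparse (by lia) hk hcycle hlam
    (fun I hI => hpow.symm ▸ by exact_mod_cast (hindep I hI).le) univ
  have hK := expansionConst_pos (by lia : 0 < r) hk (M ^ r)
  refine lt_irrefl (m : ℝ) ?_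
  calc (m : ℝ) = #(univ : Finset (Fin m)) := by simp
    _ ≤ expansionConst r (M ^ r) k * (n : ℝ) ^ (1 / (k : ℝ)) * #I := hle
    _ < expansionConst r (M ^ r) k * (n : ℝ) ^ (1 / (k : ℝ)) * n := by
        gcongr
        exact hindep I hI
    _ = expansionConst r (M ^ r) k * (n : ℝ) ^ (1 + 1 / (k : ℝ)) := by
        rw [mul_assoc, add_comm, Real.rpow_add_one (by positivity)]
    _ ≤ m := hm

theorem Arrows.exists_isRamseyNumber_le (h : Arrows r l n m) : ∃ R ≤ m, IsRamseyNumber r l n R :=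
  ⟨_, Nat.sInf_le h, isLeast_csInf ⟨m, h⟩⟩

end Ramsey

end LooseCycleRamsey

theorem theorem1p5_general (r l : ℕ) (hr : 2 ≤ r) (hl : 3 ≤ l) (hodd : Odd l) :
    ∃ c : ℝ, 0 < c ∧ ∀ n : ℕ, ∃ R : ℕ, LooseCycleRamsey.IsRamseyNumber r l n R ∧
      (R : ℝ) ≤ c * (n : ℝ) ^ (1 + 1 / ((l / 2 : ℕ) : ℝ)) := by
  obtain ⟨k, rfl⟩ := hodd
  have hk : 0 < k := by lia
  rw [show (2 * k + 1) / 2 = k by lia]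
  set K := LooseCycleRamsey.expansionConst r (((2 * k + 1) * r) ^ r) k
  have hK : 0 < K := LooseCycleRamsey.expansionConst_pos (by lia) hk _
  refine ⟨K + 1, by positivity, fun n => ?_⟩
  obtain ⟨R, hR, hRamsey⟩ := (LooseCycleRamsey.arrows_of_expansionConst_mul_le hr hk
    (Nat.le_ceil (K * (n : ℝ) ^ (1 + 1 / (k : ℝ))))).exists_isRamseyNumber_le
  refine ⟨R, hRamsey, (Nat.cast_le.2 hR).trans ?_⟩
  rcases n.eq_zero_or_pos with rfl | hn
  · have hexp : 1 + (k : ℝ)⁻¹ ≠ 0 := by positivity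
    simp [Real.zero_rpow hexp]
  · have hone : 1 ≤ (n : ℝ) ^ (1 + 1 / (k : ℝ)) :=
      Real.one_le_rpow (by exact_mod_cast hn) (by positivity)
    linarith [Nat.ceil_lt_add_one (a := K * (n : ℝ) ^ (1 + 1 / (k : ℝ))) (by positivity)]

theorem theorem1p5 (r l : ℕ) (hr : 3 ≤ r) (hl : 5 ≤ l) (hodd : Odd l) :
    ∃ c : ℝ, 0 < c ∧ ∀ n : ℕ, 1 ≤ n →
      ∃ R : ℕ, LooseCycleRamsey.IsRamseyNumber r l n R ∧
        (R : ℝ) ≤ c * (n : ℝ) ^ (1 + 1 / ((l / 2 : ℕ) : ℝ)) :=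
  let ⟨c, hc, h⟩ := theorem1p5_general r l (by lia) (by lia) hodd
  ⟨c, hc, fun n _ => h n⟩
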